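/- Let $\lambda$ be a limit ordinal. All theories below are first-order theories with equality and a membership relation $\in$ (every sort is inhabited, as usual), and a theory is \emph{consistent} if no contradiction is derivable from its axioms in classical (many-sorted) first-order logic with equality. \textbf{TST} has sorts (types) indexed by the natural numbers; $x=y$ is well formed when $x,y$ have the same type, and $x\in y$ when the type of $y$ is the successor of the type of $x$. Its axioms are extensionality, $\forall x\,\forall y\,(x=y\leftrightarrow\forall z\,(z\in x\leftrightarrow z\in y))$, for $x,y$ of type $i+1$ and $z$ of type $i$ (each $i\in\mathbb N$), and comprehension, the universal closures of $\exists A\,\forall x\,(x\in A\leftrightarrow\varphi)$, for $x$ of type $i$, $A$ of type $i+1$ (each $i\in\mathbb N$) and any formula $\varphi$ of the language of TST in which $A$ does not occur. \textbf{Tangled type theory $\mathrm{TTT}_\lambda$} has sorts indexed by the ordinals below $\lambda$; $x=y$ is well formed when $x,y$ have the same type, and $x\in y$ when the type of $y$ is strictly greater than the type of $x$. For a strictly increasing sequence $s=(s_i)_{i\in\mathbb N}$ of ordinals below $\lambda$ and a formula $\varphi$ of the language of TST, let $\varphi^s$ be the result of replacing each variable of type $i$ by a corresponding variable of type $s_i$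 (by a fixed bijection between the variables of type $i$ and those of type $s_i$, for each $i$). The axioms of $\mathrm{TTT}_\lambda$ are exactly the formulas $\varphi^s$ with $\varphi$ an axiom of TST and $s$ a strictly increasing sequence of ordinals below $\lambda$. \textbf{New Foundations (NF)} is the one-sorted theory whose axioms are extensionality, $\forall x\,\forall y\,(x=y\leftrightarrow\forall z\,(z\in x\leftrightarrow z\in y))$, and the universal closures of $\exists A\,\forall x\,(x\in A\leftrightarrow\varphi)$ for every stratified formula $\varphi$ in which $A$ does not occur. Here $\varphi$ is stratified if natural numbers $\sigma(x)$ can be assigned to its variables (bound variables being named apart) so that $\sigma(x)=\sigma(y)$ for each atomic subformula $x=y$ and $\sigma(x)+1=\sigma(y)$ for each atomic subformula $x\in y$. \textbf{Theorem.} $\mathrm{TTT}_\lambda$ is consistent if and only if NF is consistent. -/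

import Mathlib

/-!
Many-sorted first-order logic with equality and membership, and the theories TST, TTT and NF.

A language is given by a type `S` of sorts ("types") and a relation `R` on `S`: the atomic formula
`x ∈ y` is well formed when `x` has sort `s`, `y` has sort `t` and `R s t` holds; `x = y` is well
formed when `x` and `y` have the same sort. The only terms are variables.
-/

universe u

namespace Tangled

/-- Well-formed formulas. A variable is a pair of a sort and a natural number, and the sort is
always displayed. Bound variables are de Bruijn indices counted separately in each sort:
`all s φ` binds the variable of sort `s` with index `0` in `φ`, the variable of sort `s` with index
`n + 1` in `φ` is the variable with index `n` outside, and variables of the other sorts keep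
their index. -/
inductive Fml {S : Type u} (R : S → S → Prop) : Type u
  | bot : Fml R
  | eq (s : S) (m n : ℕ) : Fml R
  | mem (s t : S) (h : R s t) (m n : ℕ) : Fml R
  | imp (φ ψ : Fml R) : Fml R
  | all (s : S) (φ : Fml R) : Fml R

/-- Extend a renaming of variables under a binder of sort `s`. -/
noncomputable def lift {S : Type u} (s : S) (ρ : S → ℕ → ℕ) : S → ℕ → ℕ :=
  fun t n => open Classical in
    if t = s then (match n with | 0 => 0 | k + 1 => ρ t k + 1) else ρ t n

/-- The renaming that makes room for a new variable of sort `s` with index `0`. -/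
noncomputable def shift {S : Type u} (s : S) : S → ℕ → ℕ :=
  fun t n => open Classical in if t = s then n + 1 else n

/-- The renaming that puts variable `k` of sort `s` for the variable of sort `s` with index `0`,
and removes that index. -/
noncomputable def inst {S : Type u} (s : S) (k : ℕ) : S → ℕ → ℕ :=
  fun t n => open Classical in
    if t = s then (match n with | 0 => k | j + 1 => j) else n

namespace Fml

variable {S : Type u} {R : S → S → Prop}

def neg (φ : Fml R) : Fml R := imp φ bot

def and (φ ψ : Fml R) : Fml R := neg (imp φ (neg ψ))

def iff (φ ψ : Fml R) : Fml R := and (imp φ ψ) (imp ψ φ)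

def ex (s : S) (φ : Fml R) : Fml R := neg (all s (neg φ))

/-- Capture-free renaming of the free variables. -/
noncomputable def rename : (S → ℕ → ℕ) → Fml R → Fml R
  | _, bot => bot
  | ρ, eq s m n => eq s (ρ s m) (ρ s n)
  | ρ, mem s t h m n => mem s t h (ρ s m) (ρ t n)
  | ρ, imp φ ψ => imp (rename ρ φ) (rename ρ ψ)
  | ρ, all s φ => all s (rename (lift s ρ) φ)

/-- The variable of sort `s` with index `n` occurs free in the formula. -/
def FreeIn (s : S) : ℕ → Fml R → Prop
  | _, bot => False
  | n, eq t a b => s = t ∧ (n = a ∨ n = b)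
  | n, mem t t' _ a b => (s = t ∧ n = a) ∨ (s = t' ∧ n = b)
  | n, imp φ ψ => FreeIn s n φ ∨ FreeIn s n ψ
  | n, all t φ => (s = t ∧ FreeIn s (n + 1) φ) ∨ (s ≠ t ∧ FreeIn s n φ)

def Closed (φ : Fml R) : Prop := ∀ s n, ¬ FreeIn s n φ

/-- Prefix a formula with universal quantifiers of the given sorts. -/
def alls (ss : List S) (φ : Fml R) : Fml R := ss.foldr all φ

/-- `ψ` is a universal closure of `φ`: a sentence obtained from `φ` by prefixing universal
quantifiers. -/
def IsUnivClosure (ψ φ : Fml R) : Prop := (∃ ss : List S, ψ = alls ss φ) ∧ Closed ψ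

/-- Replace each variable of sort `i` by the variable of sort `f i` with the same index. This is
used for injective `f` only, where each variable stays bound by the same quantifier. -/
def mapSort {S' : Type*} {R' : S' → S' → Prop} (f : S → S')
    (hf : ∀ s t, R s t → R' (f s) (f t)) : Fml R → Fml R'
  | bot => bot
  | eq s m n => eq (f s) m n
  | mem s t h m n => mem (f s) (f t) (hf s t h) m n
  | imp φ ψ => imp (mapSort f hf φ) (mapSort f hf ψ)
  | all s φ => all (f s) (mapSort f hf φ)

end Fml

/-- Classical natural deduction for many-sorted first-order logic with equality (as usual, every
sort is taken to be inhabited). `Proves Γ φ` says that `φ` is derivable from assumptions in `Γ`. -/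
inductive Proves {S : Type u} {R : S → S → Prop} : Set (Fml R) → Fml R → Prop
  | assumption {Γ : Set (Fml R)} {φ : Fml R} : φ ∈ Γ → Proves Γ φ
  | impI {Γ : Set (Fml R)} {φ ψ : Fml R} : Proves (insert φ Γ) ψ → Proves Γ (.imp φ ψ)
  | impE {Γ : Set (Fml R)} {φ ψ : Fml R} : Proves Γ (.imp φ ψ) → Proves Γ φ → Proves Γ ψ
  | byContra {Γ : Set (Fml R)} {φ : Fml R} : Proves (insert φ.neg Γ) .bot → Proves Γ φ
  | allI {Γ : Set (Fml R)} (s : S) {φ : Fml R} :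
      Proves (Fml.rename (shift s) '' Γ) φ → Proves Γ (.all s φ)
  | allE {Γ : Set (Fml R)} (s : S) {φ : Fml R} (k : ℕ) :
      Proves Γ (.all s φ) → Proves Γ (φ.rename (inst s k))
  | eqRefl {Γ : Set (Fml R)} (s : S) (k : ℕ) : Proves Γ (.eq s k k)
  | eqSubst {Γ : Set (Fml R)} (s : S) {φ : Fml R} (j k : ℕ) :
      Proves Γ (.eq s j k) → Proves Γ (φ.rename (inst s j)) → Proves Γ (φ.rename (inst s k))

/-- A set of axioms is consistent if no contradiction can be derived from it. -/
def Consistent {S : Type u} {R : S → S → Prop} (T : Set (Fml R)) : Prop := ¬ Proves T .bot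

/-! ### The simple theory of types -/

/-- The language of TST: sorts are natural numbers, and membership goes from each type to the
next one. -/
abbrev TSTRel (i j : ℕ) : Prop := j = i + 1

/-- `∀ x y, x = y ↔ ∀ z, z ∈ x ↔ z ∈ y`, with `x`, `y` of type `i + 1` and `z` of type `i`. -/
def tstExt (i : ℕ) : Fml TSTRel :=
  .all (i + 1) (.all (i + 1) (.iff (.eq (i + 1) 1 0)
    (.all i (.iff (.mem i (i + 1) rfl 0 1) (.mem i (i + 1) rfl 0 0)))))

/-- `∃ A, ∀ x, x ∈ A ↔ φ`, with `x` of type `i` and `A` of type `i + 1`. Here `x` is the variable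
of type `i` with index `0` in `φ`, and the shift keeps the new variable `A` out of `φ`. -/
noncomputable def tstComp (i : ℕ) (φ : Fml TSTRel) : Fml TSTRel :=
  .ex (i + 1) (.all i (.iff (.mem i (i + 1) rfl 0 0) (φ.rename (shift (i + 1)))))

/-- The axioms of TST: extensionality and the universal closures of comprehension. -/
def TST : Set (Fml TSTRel) :=
  {ψ | (∃ i, ψ = tstExt i) ∨ ∃ i φ, ψ.IsUnivClosure (tstComp i φ)}

/-! ### Tangled type theory -/

/-- The language of `TTT lam`: sorts are the ordinals below `lam`, and membership goes from each
type to every strictly higher one. -/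
abbrev TTTRel (lam : Ordinal.{u}) (a b : Set.Iio lam) : Prop := a < b

/-- `φ^s`: each variable of type `i` is replaced by the corresponding variable of type `s i`. -/
def tangle {lam : Ordinal.{u}} (s : ℕ → Set.Iio lam) (hs : StrictMono s) (φ : Fml TSTRel) :
    Fml (TTTRel lam) :=
  φ.mapSort s fun i j (h : j = i + 1) => hs (h.symm ▸ Nat.lt_succ_self i)

/-- The axioms of `TTT lam`: all `φ^s` with `φ` an axiom of TST and `s` a strictly increasing
sequence of ordinals below `lam`. -/
def TTT (lam : Ordinal.{u}) : Set (Fml (TTTRel lam)) :=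
  {ψ | ∃ (s : ℕ → Set.Iio lam) (hs : StrictMono s), ∃ φ ∈ TST, ψ = tangle s hs φ}

/-! ### New Foundations -/

/-- The language of NF: a single sort, and membership without restriction. -/
abbrev NFRel (_ _ : Unit) : Prop := True

/-- `σ` assigns natural numbers to the free variables and can be continued to the bound
variables so that `x` and `y` get equal numbers in each subformula `x = y`, and `y` gets the
successor of the number of `x` in each subformula `x ∈ y`. -/
def IsStratification : (ℕ → ℕ) → Fml NFRel → Prop
  | _, .bot => True
  | σ, .eq _ m n => σ m = σ n
  | σ, .mem _ _ _ m n => σ m + 1 = σ n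
  | σ, .imp φ ψ => IsStratification σ φ ∧ IsStratification σ ψ
  | σ, .all _ φ =>
      ∃ k, IsStratification (fun n => match n with | 0 => k | j + 1 => σ j) φ

def Stratified (φ : Fml NFRel) : Prop := ∃ σ, IsStratification σ φ

/-- `∀ x y, x = y ↔ ∀ z, z ∈ x ↔ z ∈ y`. -/
def nfExt : Fml NFRel :=
  .all () (.all () (.iff (.eq () 1 0)
    (.all () (.iff (.mem () () trivial 0 2) (.mem () () trivial 0 1)))))

/-- `∃ A, ∀ x, x ∈ A ↔ φ`. Here `x` is the variable with index `0` in `φ`; the new variable `A`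
has index `1` under the two quantifiers and is kept out of `φ`. -/
noncomputable def nfComp (φ : Fml NFRel) : Fml NFRel :=
  .ex () (.all () (.iff (.mem () () trivial 0 1) (φ.rename (lift () (shift ())))))

/-- The axioms of NF: extensionality and the universal closures of stratified comprehension. -/
def NF : Set (Fml NFRel) :=
  {ψ | ψ = nfExt ∨ ∃ φ, Stratified φ ∧ ψ.IsUnivClosure (nfComp φ)}

end Tangled

/-!
The proof is semantic: in both directions a model of one theory is turned into a model of the other.
Soundness (`Model.sound`) and the completeness theorem for sentences over countably many sorts
(`exists_model`) pass between consistency and models. Equality is interpreted by a congruence, so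
that no quotients have to be formed.

From NF to TTT: given a model of NF, let every type be that model. A formula of TST becomes a
stratified formula when its types are forgotten (`toNF`), so comprehension for it follows from
stratified comprehension (`sat_TST_of_sat_NF`).

From TTT to NF: since `lam` is a limit ordinal, the types may be taken to be the natural numbers
(`consistent_natTTT`); let `M` be a model. Each increasing sequence `s` of types gives a model of TST.
A model of TST all of whose types are equal is needed, and it is found as an iterated ultrapower.
Iterating a nonprincipal ultrafilter on `ℕ` along `ℤ` yields an ultrafilter on the sequences
`s : ℤ → ℕ` (`seqUltrafilter`) for which almost every `s` is increasing on any given finite window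
(`eventually_lt_succ`), and which is invariant under translation as far as predicates that look at
finitely many terms are concerned (`eventually_move_iff`). The elements of the ultrapower are the
functions of `s` that look at finitely many terms; translation moves such a function from each type
to the next one, so one and the same set of functions serves for all types. Łoś's theorem holds
(`sat_ultrapower`), because a witness for an existential formula can again be chosen by looking at
finitely many terms. Hence the ultrapower is a model of TST with all types equal. Since each
stratified formula has the meaning of a formula of TST there (`exists_tst_of_isStratification`), it
is a model of NF (`sat_NF_of_sat_TST`).

The iteration of the ultrafilter plays the part of Ramsey's theorem, and translation gives the
type-shifting automorphism that Specker's theorem extracts from typical ambiguity.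
-/

namespace Tangled

/-! ### Assignments and renamings -/

/-- Extend an assignment `v` by the value `d` for the variable of sort `s` with index `0`. -/
noncomputable def cons {S : Type*} {D : Type*} (s : S) (d : D) (v : S → ℕ → D) : S → ℕ → D :=
  fun t n => open Classical in
    if t = s then (match n with | 0 => d | k + 1 => v t k) else v t n

section Renaming

variable {S : Type u} {D : Type*}

@[simp] theorem cons_self_zero (s : S) (d : D) (v : S → ℕ → D) : cons s d v s 0 = d := by
  simp [cons]

@[simp] theorem cons_self_succ (s : S) (d : D) (v : S → ℕ → D) (n : ℕ) :
    cons s d v s (n + 1) = v s n := by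
  simp [cons]

theorem cons_of_ne {s t : S} (h : t ≠ s) (d : D) (v : S → ℕ → D) (n : ℕ) :
    cons s d v t n = v t n := by
  simp [cons, h]

@[simp] theorem shift_self (s : S) (n : ℕ) : shift s s n = n + 1 := by simp [shift]

theorem shift_of_ne {s t : S} (h : t ≠ s) (n : ℕ) : shift s t n = n := by simp [shift, h]

theorem lift_eq_cons (s : S) (ρ : S → ℕ → ℕ) :
    lift s ρ = cons s 0 (fun t n => shift s t (ρ t n)) := by
  funext t n
  by_cases h : t = s
  · subst h; cases n <;> simp [lift]
  · simp [lift, cons_of_ne, shift_of_ne, h]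

theorem inst_eq_cons (s : S) (k : ℕ) : inst s k = cons s k (fun _ n => n) := by
  funext t n
  by_cases h : t = s
  · subst h; cases n <;> simp [inst]
  · simp [inst, cons_of_ne, h]

theorem comp_cons {D' : Type*} (s : S) (d : D) (v : S → ℕ → D) (f : S → D → D') :
    (fun t n => f t (cons s d v t n)) = cons s (f s d) (fun t n => f t (v t n)) := by
  funext t n
  by_cases h : t = s
  · subst h; cases n <;> simp
  · simp [cons_of_ne, h]

theorem cons_shift (s : S) (d : D) (v : S → ℕ → D) (t : S) (n : ℕ) :
    cons s d v t (shift s t n) = v t n := by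
  by_cases h : t = s
  · subst h; simp
  · simp [cons_of_ne, shift_of_ne, h]

theorem inst_shift (s : S) (k : ℕ) (t : S) (n : ℕ) : inst s k t (shift s t n) = n := by
  rw [inst_eq_cons, cons_shift]

theorem cons_comp_lift (s : S) (d : D) (v : S → ℕ → D) (ρ : S → ℕ → ℕ) :
    (fun t n => cons s d v t (lift s ρ t n)) = cons s d (fun t n => v t (ρ t n)) := by
  rw [lift_eq_cons, comp_cons]
  simp [cons_shift]

theorem comp_inst (s : S) (k : ℕ) (v : S → ℕ → D) :
    (fun t n => v t (inst s k t n)) = cons s (v s k) v := by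
  rw [inst_eq_cons, comp_cons]

theorem lift_comp_lift (s : S) (ρ ρ' : S → ℕ → ℕ) :
    (fun t n => lift s ρ' t (lift s ρ t n)) = lift s (fun t n => ρ' t (ρ t n)) := by
  rw [lift_eq_cons s ρ', cons_comp_lift, ← lift_eq_cons s (fun t n => ρ' t (ρ t n))]

theorem lift_comp_shift (s : S) (ρ : S → ℕ → ℕ) (t : S) (n : ℕ) :
    lift s ρ t (shift s t n) = shift s t (ρ t n) := by
  rw [lift_eq_cons, cons_shift]

theorem lift_id (s : S) : lift s (fun _ n => n) = fun _ n => n := by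
  funext t n
  by_cases h : t = s
  · subst h; cases n <;> simp [lift_eq_cons]
  · simp [lift_eq_cons, cons_of_ne, shift_of_ne, h]

namespace Fml

variable {R : S → S → Prop}

theorem rename_rename (φ : Fml R) : ∀ ρ ρ' : S → ℕ → ℕ,
    (φ.rename ρ).rename ρ' = φ.rename (fun t n => ρ' t (ρ t n)) := by
  induction φ with
  | bot => intros; rfl
  | eq => intros; rfl
  | mem => intros; rfl
  | imp φ ψ h₁ h₂ => intro ρ ρ'; simp [rename, h₁, h₂]
  | all s φ h => intro ρ ρ'; simp [rename, h, lift_comp_lift]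

theorem rename_congr (φ : Fml R) : ∀ ρ ρ' : S → ℕ → ℕ,
    (∀ t n, FreeIn t n φ → ρ t n = ρ' t n) → φ.rename ρ = φ.rename ρ' := by
  induction φ with
  | bot => intros; rfl
  | eq s m n => intro ρ ρ' h; simp [rename, h s m (by simp [FreeIn]), h s n (by simp [FreeIn])]
  | mem s t _ m n =>
    intro ρ ρ' h; simp [rename, h s m (by simp [FreeIn]), h t n (by simp [FreeIn])]
  | imp φ ψ h₁ h₂ =>
    intro ρ ρ' h
    simp only [rename]
    rw [h₁ ρ ρ' fun t n hf => h t n (Or.inl hf), h₂ ρ ρ' fun t n hf => h t n (Or.inr hf)]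
  | all s φ ih =>
    intro ρ ρ' h
    simp only [rename]
    rw [ih (lift s ρ) (lift s ρ')]
    intro t n hf
    by_cases hts : t = s
    · subst hts
      cases n with
      | zero => simp [lift_eq_cons]
      | succ n => simp [lift_eq_cons, h t n (Or.inl ⟨rfl, hf⟩)]
    · simp [lift_eq_cons, cons_of_ne, hts, h t n (Or.inr ⟨hts, hf⟩)]

theorem rename_id (φ : Fml R) : φ.rename (fun _ n => n) = φ := by
  induction φ with
  | bot => rfl
  | eq => rfl
  | mem => rfl
  | imp φ ψ h₁ h₂ => simp [rename, h₁, h₂]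
  | all s φ h => simp [rename, lift_id, h]

theorem rename_inst_rename (φ : Fml R) (s : S) (k : ℕ) (ρ : S → ℕ → ℕ) :
    (φ.rename (inst s k)).rename ρ = (φ.rename (lift s ρ)).rename (inst s (ρ s k)) := by
  rw [rename_rename, rename_rename, comp_inst, inst_eq_cons s (ρ s k), cons_comp_lift]

/-- Finitely many quantifiers suffice to bind all free variables: `ss` lists their sorts, with
enough repetitions of each sort. -/
theorem exists_sort_bound (φ : Fml R) : ∃ ss : List S, ∀ t n, FreeIn t n φ →
    n < open Classical in ss.count t := by
  classical
  induction φ with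
  | bot => exact ⟨[], fun t n h => h.elim⟩
  | eq s m n =>
    refine ⟨List.replicate (m + n + 1) s, ?_⟩
    rintro t k ⟨rfl, rfl | rfl⟩ <;> simp
  | mem s s' _ m n =>
    refine ⟨List.replicate (m + 1) s ++ List.replicate (n + 1) s', ?_⟩
    rintro t k (⟨rfl, rfl⟩ | ⟨rfl, rfl⟩) <;> simp only [List.count_append, List.count_replicate_self]
      <;> omega
  | imp φ ψ h₁ h₂ =>
    obtain ⟨l₁, h₁⟩ := h₁
    obtain ⟨l₂, h₂⟩ := h₂
    refine ⟨l₁ ++ l₂, fun t n h => ?_⟩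
    rw [List.count_append]
    rcases h with h | h
    · have := h₁ t n h; omega
    · have := h₂ t n h; omega
  | all s φ h =>
    obtain ⟨l, h⟩ := h
    refine ⟨l, fun t n hf => ?_⟩
    rcases hf with ⟨_, hf⟩ | ⟨_, hf⟩
    · have := h t _ hf; omega
    · exact h t n hf

theorem exists_free_bound (φ : Fml R) : ∃ N, ∀ t n, FreeIn t n φ → n < N := by
  classical
  obtain ⟨ss, h⟩ := φ.exists_sort_bound
  exact ⟨ss.length, fun t n hf => (h t n hf).trans_le List.count_le_length⟩

theorem freeIn_alls (ss : List S) (φ : Fml R) (t : S) : ∀ n, FreeIn t n (alls ss φ) →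
    FreeIn t (n + open Classical in ss.count t) φ := by
  classical
  induction ss with
  | nil => intro n h; exact h
  | cons s ss ih =>
    rintro n (⟨rfl, h⟩ | ⟨hne, h⟩)
    · have := ih _ h
      rw [List.count_cons_self]
      convert this using 1; omega
    · rw [List.count_cons_of_ne (Ne.symm hne)]
      exact ih _ h

theorem exists_isUnivClosure (φ : Fml R) : ∃ ψ : Fml R, ψ.IsUnivClosure φ := by
  classical
  obtain ⟨ss, h⟩ := φ.exists_sort_bound
  refine ⟨alls ss φ, ⟨ss, rfl⟩, fun t n hf => ?_⟩
  have := h t _ (freeIn_alls ss φ t n hf)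
  omega

end Fml

end Renaming

/-! ### Derivations -/

section Derivations

variable {S : Type u} {R : S → S → Prop}

open Fml

theorem Proves.mono {Γ Δ : Set (Fml R)} {φ : Fml R} (h : Proves Γ φ) (hΔ : Γ ⊆ Δ) :
    Proves Δ φ := by
  induction h generalizing Δ with
  | assumption h => exact .assumption (hΔ h)
  | impI _ ih => exact .impI (ih (Set.insert_subset_insert hΔ))
  | impE _ _ ih₁ ih₂ => exact .impE (ih₁ hΔ) (ih₂ hΔ)
  | byContra _ ih => exact .byContra (ih (Set.insert_subset_insert hΔ))
  | allI s _ ih => exact .allI s (ih (Set.image_mono hΔ))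
  | allE s k _ ih => exact .allE s k (ih hΔ)
  | eqRefl s k => exact .eqRefl s k
  | eqSubst s j k _ _ ih₁ ih₂ => exact .eqSubst s j k (ih₁ hΔ) (ih₂ hΔ)

theorem image_rename_shift (s : S) (ρ : S → ℕ → ℕ) (Γ : Set (Fml R)) :
    rename (lift s ρ) '' (rename (shift s) '' Γ) = rename (shift s) '' (rename ρ '' Γ) := by
  simp only [Set.image_image, rename_rename, lift_comp_shift]

theorem Proves.rename {Γ : Set (Fml R)} {φ : Fml R} (h : Proves Γ φ) :
    ∀ ρ : S → ℕ → ℕ, Proves (Fml.rename ρ '' Γ) (φ.rename ρ) := by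
  induction h with
  | assumption h => intro ρ; exact .assumption (Set.mem_image_of_mem _ h)
  | impI _ ih => intro ρ; have := ih ρ; rw [Set.image_insert_eq] at this; exact .impI this
  | impE _ _ ih₁ ih₂ => intro ρ; exact .impE (ih₁ ρ) (ih₂ ρ)
  | byContra _ ih =>
    intro ρ; have := ih ρ; rw [Set.image_insert_eq] at this; exact .byContra this
  | allI s _ ih =>
    intro ρ
    refine .allI s ?_
    rw [← image_rename_shift]
    exact ih (lift s ρ)
  | allE s k _ ih =>
    intro ρ
    rw [rename_inst_rename]
    exact .allE s _ (ih ρ)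
  | eqRefl s k => intro ρ; exact .eqRefl s _
  | eqSubst s j k _ _ ih₁ ih₂ =>
    intro ρ
    rw [rename_inst_rename]
    refine .eqSubst s _ _ (ih₁ ρ) ?_
    rw [← rename_inst_rename]
    exact ih₂ ρ

/-- Generalization on a constant: a variable that is free neither in the assumptions nor in
`∀ φ` can be quantified away. -/
theorem Proves.all_of_fresh {Γ : Set (Fml R)} {φ : Fml R} {s : S} {c : ℕ}
    (h : Proves Γ (φ.rename (inst s c))) (hΓ : ∀ γ ∈ Γ, ¬ FreeIn s c γ)
    (hφ : ¬ FreeIn s c (.all s φ)) : Proves Γ (.all s φ) := by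
  classical
  -- `ρ` makes room for the new bound variable and moves `c` into that room
  let ρ : S → ℕ → ℕ := fun t n => if t = s ∧ n = c then 0 else shift s t n
  have h' := h.rename ρ
  have hΓ' : Fml.rename ρ '' Γ = Fml.rename (shift s) '' Γ := by
    refine Set.image_congr fun γ hγ => rename_congr γ _ _ fun t n hf => ?_
    have : ¬ (t = s ∧ n = c) := by
      rintro ⟨rfl, rfl⟩; exact hΓ γ hγ hf
    simp [ρ, this]
  have hφ' : (φ.rename (inst s c)).rename ρ = φ := by
    rw [rename_rename]
    conv_rhs => rw [← rename_id φ]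
    refine rename_congr φ _ _ fun t n hf => ?_
    by_cases hts : t = s
    · subst hts
      cases n with
      | zero => simp [inst_eq_cons, ρ]
      | succ n =>
        have : n ≠ c := by
          rintro rfl; exact hφ (Or.inl ⟨rfl, hf⟩)
        simp [inst_eq_cons, ρ, this]
    · simp [inst_eq_cons, cons_of_ne, ρ, hts, shift_of_ne]
  rw [hΓ', hφ'] at h'
  exact .allI s h'

/-- Derivations use finitely many assumptions; stated for increasing unions. -/
theorem Proves.exists_of_subset_iUnion {Γ : Set (Fml R)} {φ : Fml R} (h : Proves Γ φ) :
    ∀ G : ℕ → Set (Fml R), Monotone G → Γ ⊆ ⋃ k, G k → ∃ k, Proves (G k) φ := by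
  have insert_aux : ∀ (G : ℕ → Set (Fml R)) (Γ : Set (Fml R)) (φ : Fml R), Γ ⊆ ⋃ k, G k →
      insert φ Γ ⊆ ⋃ k, insert φ (G k) := by
    rintro G Γ φ hΓ ψ (rfl | hψ)
    · exact Set.mem_iUnion.2 ⟨0, Set.mem_insert _ _⟩
    · obtain ⟨k, hk⟩ := Set.mem_iUnion.1 (hΓ hψ)
      exact Set.mem_iUnion.2 ⟨k, Set.mem_insert_of_mem _ hk⟩
  induction h with
  | assumption h =>
    intro G _ hΓ
    obtain ⟨k, hk⟩ := Set.mem_iUnion.1 (hΓ h)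
    exact ⟨k, .assumption hk⟩
  | @impI Γ φ ψ _ ih =>
    intro G hG hΓ
    obtain ⟨k, hk⟩ := ih (fun k => insert φ (G k))
      (fun a b hab => Set.insert_subset_insert (hG hab)) (insert_aux _ _ _ hΓ)
    exact ⟨k, .impI hk⟩
  | impE _ _ ih₁ ih₂ =>
    intro G hG hΓ
    obtain ⟨k, hk⟩ := ih₁ G hG hΓ
    obtain ⟨l, hl⟩ := ih₂ G hG hΓ
    exact ⟨max k l, .impE (hk.mono (hG (le_max_left k l))) (hl.mono (hG (le_max_right k l)))⟩
  | @byContra Γ φ _ ih =>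
    intro G hG hΓ
    obtain ⟨k, hk⟩ := ih (fun k => insert φ.neg (G k))
      (fun a b hab => Set.insert_subset_insert (hG hab)) (insert_aux _ _ _ hΓ)
    exact ⟨k, .byContra hk⟩
  | allI s _ ih =>
    intro G hG hΓ
    obtain ⟨k, hk⟩ := ih (fun k => Fml.rename (shift s) '' G k)
      (fun a b hab => Set.image_mono (hG hab))
      (by rw [← Set.image_iUnion]; exact Set.image_mono hΓ)
    exact ⟨k, .allI s hk⟩
  | allE s k _ ih =>
    intro G hG hΓ
    obtain ⟨l, hl⟩ := ih G hG hΓ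
    exact ⟨l, .allE s k hl⟩
  | eqRefl s k => intro G _ _; exact ⟨0, .eqRefl s k⟩
  | eqSubst s i j _ _ ih₁ ih₂ =>
    intro G hG hΓ
    obtain ⟨k, hk⟩ := ih₁ G hG hΓ
    obtain ⟨l, hl⟩ := ih₂ G hG hΓ
    exact ⟨max k l, .eqSubst s i j (hk.mono (hG (le_max_left k l)))
      (hl.mono (hG (le_max_right k l)))⟩

end Derivations

/-! ### Renaming of sorts -/

section MapSort

variable {S S' : Type*} {R : S → S → Prop} {R' : S' → S' → Prop}

open Fml

theorem mapSort_rename {f : S → S'} (hinj : Function.Injective f)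
    (hf : ∀ s t, R s t → R' (f s) (f t)) (φ : Fml R) :
    ∀ (ρ : S → ℕ → ℕ) (ρ' : S' → ℕ → ℕ), (∀ s n, ρ' (f s) n = ρ s n) →
      (φ.rename ρ).mapSort f hf = (φ.mapSort f hf).rename ρ' := by
  induction φ with
  | bot => intros; rfl
  | eq => intro ρ ρ' h; simp [rename, mapSort, h]
  | mem => intro ρ ρ' h; simp [rename, mapSort, h]
  | imp φ ψ h₁ h₂ => intro ρ ρ' h; simp [rename, mapSort, h₁ ρ ρ' h, h₂ ρ ρ' h]
  | all s φ ih =>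
    intro ρ ρ' h
    simp only [rename, mapSort]
    rw [ih (lift s ρ) (lift (f s) ρ')]
    intro t n
    by_cases hts : t = s
    · subst hts; cases n <;> simp [lift_eq_cons, h]
    · have : f t ≠ f s := hinj.ne hts
      simp [lift_eq_cons, cons_of_ne, shift_of_ne, hts, this, h]

theorem shift_apply_injective {f : S → S'} (hinj : Function.Injective f) (s t : S) (n : ℕ) :
    shift (f s) (f t) n = shift s t n := by
  by_cases h : t = s
  · simp [h]
  · simp [shift, h, hinj.ne h]

theorem inst_apply_injective {f : S → S'} (hinj : Function.Injective f) (s : S) (k : ℕ) (t : S)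
    (n : ℕ) : inst (f s) k (f t) n = inst s k t n := by
  by_cases h : t = s
  · subst h; simp [inst]
  · simp [inst, h, hinj.ne h]

theorem Proves.mapSort {f : S → S'} (hinj : Function.Injective f)
    (hf : ∀ s t, R s t → R' (f s) (f t)) {Γ : Set (Fml R)} {φ : Fml R} (h : Proves Γ φ) :
    Proves (Fml.mapSort (R' := R') f hf '' Γ) (φ.mapSort f hf) := by
  have hinst : ∀ (φ : Fml R) s k, (φ.rename (inst s k)).mapSort f hf =
      (φ.mapSort f hf).rename (inst (f s) k) := fun φ s k =>
    mapSort_rename hinj hf φ _ _ (inst_apply_injective hinj s k)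
  induction h with
  | assumption h => exact .assumption (Set.mem_image_of_mem _ h)
  | impI _ ih => rw [Set.image_insert_eq] at ih; exact .impI ih
  | impE _ _ ih₁ ih₂ => exact .impE ih₁ ih₂
  | byContra _ ih => rw [Set.image_insert_eq] at ih; exact .byContra ih
  | allI s _ ih =>
    refine .allI (f s) ?_
    convert ih using 1
    rw [Set.image_image, Set.image_image]
    exact Set.image_congr fun γ _ =>
      (mapSort_rename hinj hf γ _ _ (shift_apply_injective hinj s)).symm
  | allE s k _ ih => rw [hinst]; exact .allE (f s) k ih
  | eqRefl s k => exact .eqRefl (f s) k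
  | eqSubst s j k _ _ ih₁ ih₂ =>
    rw [hinst] at ih₂ ⊢
    exact .eqSubst (f s) j k ih₁ ih₂

theorem freeIn_mapSort {f : S → S'} (hinj : Function.Injective f)
    (hf : ∀ s t, R s t → R' (f s) (f t)) (φ : Fml R) (t' : S') : ∀ n,
    FreeIn t' n (φ.mapSort f hf) → ∃ t, t' = f t ∧ FreeIn t n φ := by
  induction φ with
  | bot => intro n h; exact h.elim
  | eq s a b => rintro n ⟨rfl, h⟩; exact ⟨s, rfl, rfl, h⟩
  | mem s t _ a b =>
    rintro n (⟨rfl, h⟩ | ⟨rfl, h⟩)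
    · exact ⟨s, rfl, Or.inl ⟨rfl, h⟩⟩
    · exact ⟨t, rfl, Or.inr ⟨rfl, h⟩⟩
  | imp φ ψ h₁ h₂ =>
    rintro n (h | h)
    · obtain ⟨t, rfl, ht⟩ := h₁ n h; exact ⟨t, rfl, Or.inl ht⟩
    · obtain ⟨t, rfl, ht⟩ := h₂ n h; exact ⟨t, rfl, Or.inr ht⟩
  | all s φ ih =>
    rintro n (⟨rfl, h⟩ | ⟨hne, h⟩)
    · obtain ⟨t, hst, ht⟩ := ih _ h
      obtain rfl := hinj hst
      exact ⟨s, rfl, Or.inl ⟨rfl, ht⟩⟩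
    · obtain ⟨t, rfl, ht⟩ := ih _ h
      exact ⟨t, rfl, Or.inr ⟨fun e => hne (congrArg f e), ht⟩⟩

theorem mapSort_mapSort {S'' : Type*} {R'' : S'' → S'' → Prop} (f : S → S') (g : S' → S'')
    (hf : ∀ s t, R s t → R' (f s) (f t)) (hg : ∀ s t, R' s t → R'' (g s) (g t))
    (hgf : ∀ s t, R s t → R'' (g (f s)) (g (f t))) (φ : Fml R) :
    (φ.mapSort f hf).mapSort g hg = φ.mapSort (R' := R'') (fun s => g (f s)) hgf := by
  induction φ with
  | bot => rfl
  | eq => rfl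
  | mem => rfl
  | imp φ ψ h₁ h₂ => simp [mapSort, h₁, h₂]
  | all s φ h => simp [mapSort, h]

end MapSort

/-! ### Models -/

/-- A structure for the language with sorts `S`. The same type `D` carries all sorts; equality of
each sort is interpreted by an equivalence relation that is compatible with membership, and
membership is given between any two sorts. -/
structure Model (S : Type*) (D : Type*) where
  E : S → D → D → Prop
  mem : S → S → D → D → Prop
  refl : ∀ s a, E s a a
  symm : ∀ s a b, E s a b → E s b a
  trans : ∀ s a b c, E s a b → E s b c → E s a c
  mem_congr : ∀ s t a a' b b', E s a a' → E t b b' → mem s t a b → mem s t a' b'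

namespace Model

/-- The structure whose sort `s` is the sort `f s` of `M`. -/
def comap {S S' : Type*} {D : Type*} (M : Model S' D) (f : S → S') : Model S D where
  E s := M.E (f s)
  mem s t := M.mem (f s) (f t)
  refl s := M.refl (f s)
  symm s := M.symm (f s)
  trans s := M.trans (f s)
  mem_congr s t := M.mem_congr (f s) (f t)

variable {S : Type u} {D : Type*} {R : S → S → Prop}

/-- Truth of a formula under an assignment. -/
def Sat (M : Model S D) : (S → ℕ → D) → Fml R → Prop
  | _, .bot => False
  | v, .eq s m n => M.E s (v s m) (v s n)
  | v, .mem s t _ m n => M.mem s t (v s m) (v t n)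
  | v, .imp φ ψ => M.Sat v φ → M.Sat v ψ
  | v, .all s φ => ∀ d, M.Sat (cons s d v) φ

section Sat

variable (M : Model S D) (v : S → ℕ → D)

@[simp] theorem sat_bot : M.Sat v (.bot : Fml R) ↔ False := Iff.rfl

@[simp] theorem sat_eq (s : S) (m n : ℕ) :
    M.Sat v (.eq s m n : Fml R) ↔ M.E s (v s m) (v s n) := Iff.rfl

@[simp] theorem sat_mem (s t : S) (h : R s t) (m n : ℕ) :
    M.Sat v (.mem s t h m n) ↔ M.mem s t (v s m) (v t n) := Iff.rfl

@[simp] theorem sat_imp (φ ψ : Fml R) : M.Sat v (.imp φ ψ) ↔ (M.Sat v φ → M.Sat v ψ) := Iff.rfl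

@[simp] theorem sat_all (s : S) (φ : Fml R) :
    M.Sat v (.all s φ) ↔ ∀ d, M.Sat (cons s d v) φ := Iff.rfl

@[simp] theorem sat_neg (φ : Fml R) : M.Sat v φ.neg ↔ ¬ M.Sat v φ := Iff.rfl

@[simp] theorem sat_iff (φ ψ : Fml R) : M.Sat v (φ.iff ψ) ↔ (M.Sat v φ ↔ M.Sat v ψ) := by
  simp only [Fml.iff, Fml.and, sat_neg, sat_imp]; tauto

@[simp] theorem sat_ex (s : S) (φ : Fml R) :
    M.Sat v (.ex s φ) ↔ ∃ d, M.Sat (cons s d v) φ := by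
  simp [Fml.ex]

end Sat

theorem sat_rename (M : Model S D) (φ : Fml R) : ∀ (ρ : S → ℕ → ℕ) (v : S → ℕ → D),
    M.Sat v (φ.rename ρ) ↔ M.Sat (fun t n => v t (ρ t n)) φ := by
  induction φ with
  | bot => intros; rfl
  | eq => intros; rfl
  | mem => intros; rfl
  | imp φ ψ h₁ h₂ => intro ρ v; simp [Fml.rename, h₁, h₂]
  | all s φ h => intro ρ v; simp [Fml.rename, h, cons_comp_lift]

theorem sat_rename_shift (M : Model S D) (φ : Fml R) (s : S) (d : D) (v : S → ℕ → D) :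
    M.Sat (cons s d v) (φ.rename (shift s)) ↔ M.Sat v φ := by
  simp [sat_rename, cons_shift]

theorem sat_congr (M : Model S D) (φ : Fml R) : ∀ v w : S → ℕ → D,
    (∀ t n, M.E t (v t n) (w t n)) → (M.Sat v φ ↔ M.Sat w φ) := by
  induction φ with
  | bot => intros; rfl
  | eq s m n =>
    intro v w h
    exact ⟨fun e => M.trans _ _ _ _ (M.symm _ _ _ (h s m)) (M.trans _ _ _ _ e (h s n)),
      fun e => M.trans _ _ _ _ (h s m) (M.trans _ _ _ _ e (M.symm _ _ _ (h s n)))⟩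
  | mem s t _ m n =>
    intro v w h
    exact ⟨M.mem_congr _ _ _ _ _ _ (h s m) (h t n),
      M.mem_congr _ _ _ _ _ _ (M.symm _ _ _ (h s m)) (M.symm _ _ _ (h t n))⟩
  | imp φ ψ h₁ h₂ => intro v w h; simp [h₁ v w h, h₂ v w h]
  | all s φ ih =>
    intro v w h
    refine forall_congr' fun d => ih _ _ fun t n => ?_
    by_cases hts : t = s
    · subst hts
      cases n with
      | zero => simpa using M.refl t d
      | succ n => simpa using h t n
    · simpa [cons_of_ne, hts] using h t n

theorem sound (M : Model S D) {Γ : Set (Fml R)} {φ : Fml R} (h : Proves Γ φ) :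
    ∀ v : S → ℕ → D, (∀ γ ∈ Γ, M.Sat v γ) → M.Sat v φ := by
  induction h with
  | assumption h => intro v hv; exact hv _ h
  | impI _ ih =>
    intro v hv hφ
    refine ih v ?_
    rintro γ (rfl | hγ)
    exacts [hφ, hv γ hγ]
  | impE _ _ ih₁ ih₂ => intro v hv; exact ih₁ v hv (ih₂ v hv)
  | byContra _ ih =>
    intro v hv
    by_contra hφ
    refine ih v ?_
    rintro γ (rfl | hγ)
    exacts [hφ, hv γ hγ]
  | allI s _ ih =>
    intro v hv d
    refine ih _ ?_
    rintro _ ⟨γ, hγ, rfl⟩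
    exact (M.sat_rename_shift γ s d v).2 (hv γ hγ)
  | allE s k _ ih =>
    intro v hv
    rw [sat_rename, comp_inst]
    exact ih v hv _
  | eqRefl s k => intro v _; exact M.refl s _
  | @eqSubst Γ s φ j k _ _ ih₁ ih₂ =>
    intro v hv
    have h₂ := ih₂ v hv
    rw [sat_rename, comp_inst] at h₂ ⊢
    refine (M.sat_congr φ _ _ fun t n => ?_).1 h₂
    by_cases hts : t = s
    · subst hts
      cases n with
      | zero => simpa using ih₁ v hv
      | succ n => simpa using M.refl t _
    · simpa [cons_of_ne, hts] using M.refl t _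

theorem consistent [Nonempty D] (M : Model S D) {T : Set (Fml R)}
    (h : ∀ v, ∀ φ ∈ T, M.Sat v φ) : Consistent T := fun hT =>
  M.sound hT (fun _ _ => Classical.arbitrary D) (h _)

theorem sat_alls_of_forall (M : Model S D) {φ : Fml R} (h : ∀ v, M.Sat v φ) (ss : List S) :
    ∀ v, M.Sat v (φ.alls ss) := by
  induction ss with
  | nil => exact h
  | cons s ss ih => intro v d; exact ih _

theorem forall_of_sat_alls (M : Model S D) {φ : Fml R} (ss : List S)
    (h : ∀ v, M.Sat v (φ.alls ss)) : ∀ v, M.Sat v φ := by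
  induction ss with
  | nil => exact h
  | cons s ss ih =>
    refine ih fun v => ?_
    -- every assignment is an extension of another one
    have := h (fun t n => v t (shift s t n)) (v s 0)
    have hv : cons s (v s 0) (fun t n => v t (shift s t n)) = v := by
      funext t n
      by_cases hts : t = s
      · subst hts; cases n <;> simp
      · simp [cons_of_ne, shift_of_ne, hts]
    rwa [hv] at this

theorem sat_mapSort {S S' : Type*} {R : S → S → Prop} {R' : S' → S' → Prop} {f : S → S'}
    (hinj : Function.Injective f) (hf : ∀ s t, R s t → R' (f s) (f t)) (M : Model S' D)
    (φ : Fml R) : ∀ v : S' → ℕ → D,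
      M.Sat v (φ.mapSort f hf) ↔ (M.comap f).Sat (fun s n => v (f s) n) φ := by
  induction φ with
  | bot => intros; rfl
  | eq => intros; rfl
  | mem => intros; rfl
  | imp φ ψ h₁ h₂ => intro v; simp [Fml.mapSort, h₁, h₂]
  | all s φ ih =>
    intro v
    refine forall_congr' fun d => (ih _).trans ?_
    have : (fun t n => cons (f s) d v (f t) n) = cons s d (fun t n => v (f t) n) := by
      funext t n
      by_cases hts : t = s
      · subst hts; simp [cons]
      · simp [cons, hts, hinj.ne hts]
    rw [this]

end Model

/-! ### The completeness theorem for countably many sorts -/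

section Completeness

variable {S : Type u} {R : S → S → Prop}

open Fml

theorem countable_fml [Countable S] : Countable (Fml R) := by
  obtain ⟨f, hf⟩ := exists_injective_nat S
  let code : Fml R → ℕ := fun φ => Fml.rec (motive := fun _ => ℕ) 0
    (fun s m n => 5 * Nat.pair (f s) (Nat.pair m n) + 1)
    (fun s t _ m n => 5 * Nat.pair (Nat.pair (f s) (f t)) (Nat.pair m n) + 2)
    (fun _ _ a b => 5 * Nat.pair a b + 3) (fun s _ a => 5 * Nat.pair (f s) a + 4) φ
  have hcancel : ∀ a b r : ℕ, 5 * a + r = 5 * b + r ↔ a = b := fun a b r => by omega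
  refine Function.Injective.countable (f := code) fun φ => ?_
  induction φ with
  | bot => intro ψ h; cases ψ <;> simp only [code] at h <;> first | rfl | omega
  | eq s m n =>
    intro ψ h
    cases ψ <;> simp only [code] at h <;> try omega
    simp only [hcancel, Nat.pair_eq_pair, hf.eq_iff] at h
    obtain ⟨rfl, rfl, rfl⟩ := h
    rfl
  | mem s t _ m n =>
    intro ψ h
    cases ψ <;> simp only [code] at h <;> try omega
    simp only [hcancel, Nat.pair_eq_pair, hf.eq_iff] at h
    obtain ⟨⟨rfl, rfl⟩, rfl, rfl⟩ := h
    rfl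
  | imp φ₁ φ₂ h₁ h₂ =>
    intro ψ h
    cases ψ <;> simp only [code] at h <;> try omega
    simp only [hcancel, Nat.pair_eq_pair] at h
    rw [h₁ h.1, h₂ h.2]
  | all s φ ih =>
    intro ψ h
    cases ψ <;> simp only [code] at h <;> try omega
    simp only [hcancel, Nat.pair_eq_pair] at h
    rw [hf h.1, ih h.2]

/-- From some index on, the same for all sorts, no variable is free in a formula of `Γ`. -/
def HasFresh (Γ : Set (Fml R)) : Prop :=
  ∃ N, ∀ γ ∈ Γ, ∀ s n, FreeIn s n γ → n < N

theorem HasFresh.insert {Γ : Set (Fml R)} (h : HasFresh Γ) (φ : Fml R) :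
    HasFresh (insert φ Γ) := by
  obtain ⟨N, hN⟩ := h
  obtain ⟨N', hN'⟩ := φ.exists_free_bound
  refine ⟨max N N', ?_⟩
  rintro γ (rfl | hγ) s n hf
  · exact (hN' s n hf).trans_le (le_max_right _ _)
  · exact (hN γ hγ s n hf).trans_le (le_max_left _ _)

theorem proves_of_not_consistent_insert_neg {Γ : Set (Fml R)} {φ : Fml R}
    (h : ¬ Consistent (insert φ.neg Γ)) : Proves Γ φ :=
  .byContra (not_not.1 h)

/-- One step of the Henkin construction: decide `φ`, and provide a counterexample if `φ` is a
universal statement that is refuted. -/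
theorem exists_henkin_step {Γ : Set (Fml R)} (hΓ : Consistent Γ) (hfr : HasFresh Γ) (φ : Fml R) :
    ∃ Γ', Γ ⊆ Γ' ∧ Consistent Γ' ∧ HasFresh Γ' ∧ (φ ∈ Γ' ∨ φ.neg ∈ Γ') ∧
      ∀ s ψ, φ = .all s ψ → φ ∈ Γ' ∨ ∃ c, (ψ.rename (inst s c)).neg ∈ Γ' := by
  by_cases h : Consistent (insert φ Γ)
  · exact ⟨_, Set.subset_insert _ _, h, hfr.insert φ, Or.inl (Set.mem_insert _ _),
      fun _ _ _ => Or.inl (Set.mem_insert _ _)⟩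
  have hneg : Proves Γ φ.neg := .impI (not_not.1 h)
  have h' : Consistent (insert φ.neg Γ) := fun hbot => hΓ (.impE (.impI hbot) hneg)
  by_cases hall : ∃ s ψ, φ = .all s ψ
  · obtain ⟨s, ψ, rfl⟩ := hall
    have hfr' := hfr.insert (Fml.all s ψ).neg
    obtain ⟨c, hc⟩ := hfr'
    refine ⟨insert (ψ.rename (inst s c)).neg (insert (Fml.all s ψ).neg Γ),
      (Set.subset_insert _ _).trans (Set.subset_insert _ _), ?_, (hfr.insert _).insert _,
      Or.inr (Set.mem_insert_of_mem _ (Set.mem_insert _ _)), ?_⟩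
    · by_contra hcon
      have hψ := proves_of_not_consistent_insert_neg hcon
      have hall := hψ.all_of_fresh (fun γ hγ hf => (hc γ hγ s c hf).false)
        (fun hf => (hc _ (Set.mem_insert _ _) s c (Or.inl hf)).false)
      exact h' (.impE (.assumption (Set.mem_insert _ _)) hall)
    · rintro s' ψ' he
      obtain ⟨rfl, rfl⟩ := Fml.all.inj he
      exact Or.inr ⟨c, Set.mem_insert _ _⟩
  · exact ⟨_, Set.subset_insert _ _, h', hfr.insert _, Or.inr (Set.mem_insert _ _),
      fun s ψ he => (hall ⟨s, ψ, he⟩).elim⟩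

/-- A complete consistent set of formulas in which each refuted universal statement has a
counterexample among the variables. -/
structure IsHenkin (Γ : Set (Fml R)) : Prop where
  consistent : Consistent Γ
  complete : ∀ φ, φ ∈ Γ ∨ φ.neg ∈ Γ
  witness : ∀ s φ, .all s φ ∈ Γ ∨ ∃ c, (φ.rename (inst s c)).neg ∈ Γ

theorem exists_isHenkin [Countable S] {T : Set (Fml R)} (hT : Consistent T) (hfr : HasFresh T) :
    ∃ Γ, T ⊆ Γ ∧ IsHenkin Γ := by
  have := countable_fml (R := R)
  have : Nonempty (Fml R) := ⟨.bot⟩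
  obtain ⟨e, he⟩ := exists_surjective_nat (Fml R)
  choose next hsub hcon hfresh hdec hwit using
    fun (Γ : {Γ : Set (Fml R) // Consistent Γ ∧ HasFresh Γ}) (φ : Fml R) =>
      exists_henkin_step Γ.2.1 Γ.2.2 φ
  let G : ℕ → {Γ : Set (Fml R) // Consistent Γ ∧ HasFresh Γ} := fun k =>
    Nat.rec ⟨T, hT, hfr⟩ (fun k Γ => ⟨next Γ (e k), hcon Γ (e k), hfresh Γ (e k)⟩) k
  have hG : Monotone fun k => (G k).1 := monotone_nat_of_le_succ fun k => hsub (G k) (e k)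
  have hmem : ∀ k φ, φ ∈ (G k).1 → φ ∈ ⋃ k, (G k).1 := fun k φ h => Set.mem_iUnion.2 ⟨k, h⟩
  refine ⟨⋃ k, (G k).1, fun φ hφ => hmem 0 φ hφ, ?_, ?_, ?_⟩
  · intro h
    obtain ⟨k, hk⟩ := h.exists_of_subset_iUnion _ hG subset_rfl
    exact (G k).2.1 hk
  · intro φ
    obtain ⟨k, rfl⟩ := he φ
    exact (hdec (G k) (e k)).imp (hmem (k + 1) _) (hmem (k + 1) _)
  · intro s φ
    obtain ⟨k, hk⟩ := he (.all s φ)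
    have := hwit (G k) (e k) s φ hk
    rw [hk] at this
    refine this.imp (fun h => hmem (k + 1) _ ?_) fun ⟨c, h⟩ => ⟨c, hmem (k + 1) _ ?_⟩
    · simpa [G, hk] using h
    · simpa [G, hk] using h

namespace IsHenkin

variable {Γ : Set (Fml R)}

theorem mem_of_proves (h : IsHenkin Γ) {φ : Fml R} (hφ : Proves Γ φ) : φ ∈ Γ :=
  (h.complete φ).resolve_right fun hn => h.consistent (.impE (.assumption hn) hφ)

theorem neg_mem_iff (h : IsHenkin Γ) {φ : Fml R} : φ.neg ∈ Γ ↔ φ ∉ Γ :=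
  ⟨fun hn hφ => h.consistent (.impE (.assumption hn) (.assumption hφ)),
    (h.complete φ).resolve_left⟩

theorem imp_mem_iff (h : IsHenkin Γ) {φ ψ : Fml R} :
    .imp φ ψ ∈ Γ ↔ (φ ∈ Γ → ψ ∈ Γ) := by
  refine ⟨fun hi hφ => h.mem_of_proves (.impE (.assumption hi) (.assumption hφ)), fun hi => ?_⟩
  refine h.mem_of_proves (.impI ?_)
  by_cases hφ : φ ∈ Γ
  · exact .assumption (Set.mem_insert_of_mem _ (hi hφ))
  · refine .byContra (.impE (φ := φ) (.assumption ?_) (.assumption ?_))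
    · exact Set.mem_insert_of_mem _ (Set.mem_insert_of_mem _ (h.neg_mem_iff.2 hφ))
    · exact Set.mem_insert_of_mem _ (Set.mem_insert _ _)

theorem all_mem_iff (h : IsHenkin Γ) {s : S} {φ : Fml R} :
    .all s φ ∈ Γ ↔ ∀ c, φ.rename (inst s c) ∈ Γ := by
  refine ⟨fun ha c => h.mem_of_proves (.allE s c (.assumption ha)), fun ha => ?_⟩
  refine (h.witness s φ).resolve_right ?_
  rintro ⟨c, hc⟩
  exact h.neg_mem_iff.1 hc (ha c)

theorem subst_mem (h : IsHenkin Γ) {s : S} {j k : ℕ} (he : .eq s j k ∈ Γ) (φ : Fml R)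
    (hφ : φ.rename (inst s j) ∈ Γ) : φ.rename (inst s k) ∈ Γ :=
  h.mem_of_proves (.eqSubst s j k (.assumption he) (.assumption hφ))

/-- The structure whose elements of each sort are the variables, and whose atomic facts are those
in the Henkin set. -/
def termModel (h : IsHenkin Γ) : Model S ℕ where
  E s m n := .eq s m n ∈ Γ
  mem s t m n := ∃ hR : R s t, .mem s t hR m n ∈ Γ
  refl s a := h.mem_of_proves (.eqRefl s a)
  symm s a b he := by
    have := h.subst_mem he (.eq s 0 (a + 1))
    simp only [rename, inst_eq_cons, cons_self_zero, cons_self_succ] at this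
    exact this (h.mem_of_proves (.eqRefl s a))
  trans s a b c he he' := by
    have := h.subst_mem he' (.eq s (a + 1) 0)
    simp only [rename, inst_eq_cons, cons_self_zero, cons_self_succ] at this
    exact this he
  mem_congr s t a a' b b' ha hb := by
    rintro ⟨hR, hm⟩
    have h₁ := h.subst_mem ha (.mem s t hR 0 (shift s t b))
    have h₂ := h.subst_mem hb (.mem s t hR (shift t s a') 0)
    simp only [rename, inst_shift] at h₁ h₂
    simp only [inst_eq_cons, cons_self_zero] at h₁ h₂
    exact ⟨hR, h₂ (h₁ hm)⟩

theorem sat_termModel (h : IsHenkin Γ) (φ : Fml R) :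
    ∀ ρ : S → ℕ → ℕ, h.termModel.Sat ρ φ ↔ φ.rename ρ ∈ Γ := by
  induction φ with
  | bot => intro ρ; exact ⟨False.elim, fun hb => h.consistent (.assumption hb)⟩
  | eq s m n => intro ρ; rfl
  | mem s t hR m n => intro ρ; exact ⟨fun ⟨_, h⟩ => h, fun h => ⟨hR, h⟩⟩
  | imp φ ψ h₁ h₂ => intro ρ; simp [rename, h₁, h₂, h.imp_mem_iff]
  | all s φ ih =>
    intro ρ
    simp only [Model.sat_all, rename, h.all_mem_iff, ih, rename_rename]
    simp [inst_eq_cons, cons_comp_lift]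

end IsHenkin

/-- A consistent set of sentences over countably many sorts has a model. -/
theorem exists_model [Countable S] {T : Set (Fml R)} (hT : Consistent T)
    (hcl : ∀ φ ∈ T, φ.Closed) : ∃ M : Model S ℕ, ∀ v, ∀ φ ∈ T, M.Sat v φ := by
  obtain ⟨Γ, hTΓ, hΓ⟩ := exists_isHenkin hT ⟨0, fun γ hγ s n hf => (hcl γ hγ s n hf).elim⟩
  refine ⟨hΓ.termModel, fun v φ hφ => ?_⟩
  rw [hΓ.sat_termModel, rename_congr φ v (fun _ n => n) fun t n hf => (hcl φ hφ t n hf).elim,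
    rename_id]
  exact hTΓ hφ

end Completeness

/-! ### A shift-invariant ultrafilter on bi-infinite sequences -/

open Filter

/-- `IsLocal f`: the value `f s` depends on finitely many terms of the sequence `s` only. -/
def IsLocal {α : Type*} (f : (ℤ → ℕ) → α) : Prop :=
  ∃ N : ℕ, DependsOn f (Set.Ico (-N : ℤ) N)

/-- The sequence `s` moved `k` places to the left. -/
def move (k : ℤ) (s : ℤ → ℕ) : ℤ → ℕ := fun i => s (i + k)

@[simp] theorem move_apply (k : ℤ) (s : ℤ → ℕ) (i : ℤ) : move k s i = s (i + k) := rfl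

@[simp] theorem move_zero (s : ℤ → ℕ) : move 0 s = s := by funext i; simp

@[simp] theorem move_move (k l : ℤ) (s : ℤ → ℕ) : move k (move l s) = move (k + l) s := by
  funext i; simp [add_assoc]

namespace IsLocal

variable {α β γ : Type*}

theorem const (a : α) : IsLocal fun _ => a := ⟨0, fun _ _ _ => rfl⟩

theorem eval (i : ℤ) : IsLocal fun s => s i :=
  ⟨i.natAbs + 1, fun _ _ h => h i (by simp only [Set.mem_Ico]; omega)⟩

theorem comp {f : (ℤ → ℕ) → α} (hf : IsLocal f) (g : α → β) : IsLocal fun s => g (f s) := by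
  obtain ⟨N, hN⟩ := hf
  exact ⟨N, fun x y h => congrArg g (hN h)⟩

theorem comp₂ {f : (ℤ → ℕ) → α} {g : (ℤ → ℕ) → β} (hf : IsLocal f) (hg : IsLocal g)
    (F : α → β → γ) : IsLocal fun s => F (f s) (g s) := by
  obtain ⟨N, hN⟩ := hf
  obtain ⟨M, hM⟩ := hg
  refine ⟨max N M, fun x y h => ?_⟩
  have h₁ : f x = f y := hN fun i hi => h i (by simp only [Set.mem_Ico] at hi ⊢; omega)
  have h₂ : g x = g y := hM fun i hi => h i (by simp only [Set.mem_Ico] at hi ⊢; omega)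
  simp only [h₁, h₂]

theorem comp_move {f : (ℤ → ℕ) → α} (hf : IsLocal f) (k : ℤ) : IsLocal fun s => f (move k s) := by
  obtain ⟨N, hN⟩ := hf
  refine ⟨N + k.natAbs, fun x y h => hN fun i hi => h _ ?_⟩
  simp only [Set.mem_Ico] at hi ⊢
  omega

end IsLocal

/-- The iterated power of a nonprincipal ultrafilter on `ℕ`, living on the terms of index
`a, a + 1, …, a + n - 1`; the other terms are `0`. -/
noncomputable def window : ℤ → ℕ → Ultrafilter (ℤ → ℕ)
  | _, 0 => pure 0
  | a, n + 1 => (hyperfilter ℕ).bind fun c =>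
      (window (a + 1) n).map fun s => Function.update s a c

theorem eventually_window_zero (a : ℤ) (P : (ℤ → ℕ) → Prop) :
    (∀ᶠ s in window a 0, P s) ↔ P 0 := Iff.rfl

theorem eventually_window_succ (a : ℤ) (n : ℕ) (P : (ℤ → ℕ) → Prop) :
    (∀ᶠ s in window a (n + 1), P s) ↔
      ∀ᶠ c in hyperfilter ℕ, ∀ᶠ s in window (a + 1) n, P (Function.update s a c) := Iff.rfl

theorem eventually_window_move (n : ℕ) : ∀ (a k : ℤ) (P : (ℤ → ℕ) → Prop),
    (∀ᶠ s in window a n, P (move k s)) ↔ ∀ᶠ s in window (a - k) n, P s := by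
  induction n with
  | zero => intro a k P; exact Iff.rfl
  | succ n ih =>
    intro a k P
    have hmove : ∀ c s, move k (Function.update s a c) =
        Function.update (move k s) (a - k) c := by
      intro c s
      funext i
      by_cases h : i = a - k
      · subst h; simp
      · simp [Function.update_of_ne h, Function.update_of_ne (show i + k ≠ a by omega)]
    simp only [eventually_window_succ, hmove]
    refine eventually_congr (.of_forall fun c => ?_)
    rw [ih (a + 1) k fun s => P (Function.update s (a - k) c),
      show a + 1 - k = a - k + 1 by ring]

/-- A window can be extended to the right without affecting predicates that do not look there. -/
theorem eventually_window_succ_right (n : ℕ) : ∀ (a : ℤ) (P : (ℤ → ℕ) → Prop),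
    DependsOn P (Set.Ico a (a + n)) →
      ((∀ᶠ s in window a (n + 1), P s) ↔ ∀ᶠ s in window a n, P s) := by
  induction n with
  | zero =>
    intro a P hP
    have : ∀ s, P s ↔ P 0 := fun s => iff_of_eq (hP fun i hi => by
      simp only [Set.mem_Ico] at hi; omega)
    simp only [this, eventually_const]
  | succ n ih =>
    intro a P hP
    rw [eventually_window_succ, eventually_window_succ a n]
    refine eventually_congr (.of_forall fun c => ih _ _ fun x y h => hP fun i hi => ?_)
    by_cases hi' : i = a
    · subst hi'; simp
    · rw [Function.update_of_ne hi', Function.update_of_ne hi']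
      refine h i ?_
      simp only [Set.mem_Ico] at hi ⊢
      push_cast at hi
      omega

theorem eventually_window_extend {N : ℕ} {P : (ℤ → ℕ) → Prop}
    (hP : DependsOn P (Set.Ico (-N : ℤ) N)) (l r : ℕ) :
    (∀ᶠ s in window (-N - l) (2 * N + l + r), P s) ↔ ∀ᶠ s in window (-N) (2 * N), P s := by
  induction r with
  | zero =>
    induction l with
    | zero => simp
    | succ l ih =>
      rw [← ih, show 2 * N + (l + 1) + 0 = 2 * N + l + 0 + 1 by ring, eventually_window_succ,
        show (-N - (l + 1 : ℕ) : ℤ) + 1 = -N - l by push_cast; ring]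
      have : ∀ c s, P (Function.update s (-N - (l + 1 : ℕ) : ℤ) c) ↔ P s := fun c s =>
        iff_of_eq (hP fun i hi => Function.update_of_ne (by
          simp only [Set.mem_Ico] at hi; push_cast; omega) _ _)
      simp only [this, eventually_const, add_zero]
  | succ r ih =>
    rw [← ih, ← add_assoc, eventually_window_succ_right]
    refine fun x y h => hP fun i hi => h i ?_
    simp only [Set.mem_Ico] at hi ⊢
    push_cast
    omega

/-- The limit of the iterated powers over growing windows around `0`. -/
noncomputable def seqUltrafilter : Ultrafilter (ℤ → ℕ) :=
  (hyperfilter ℕ).bind fun n => window (-n) (2 * n)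

theorem eventually_hyperfilter_ge (N : ℕ) : ∀ᶠ n in hyperfilter ℕ, N ≤ n :=
  Nat.hyperfilter_le_atTop (eventually_ge_atTop N)

theorem eventually_seqUltrafilter {N : ℕ} {P : (ℤ → ℕ) → Prop}
    (hP : DependsOn P (Set.Ico (-N : ℤ) N)) :
    (∀ᶠ s in seqUltrafilter, P s) ↔ ∀ᶠ s in window (-N) (2 * N), P s := by
  have : (∀ᶠ s in seqUltrafilter, P s) ↔
      ∀ᶠ n : ℕ in hyperfilter ℕ, ∀ᶠ s in window (-n) (2 * n), P s := Iff.rfl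
  rw [this]
  have key : ∀ᶠ n : ℕ in hyperfilter ℕ, ((∀ᶠ s in window (-n) (2 * n), P s) ↔
      ∀ᶠ s in window (-N) (2 * N), P s) := by
    filter_upwards [eventually_hyperfilter_ge N] with n hn
    obtain ⟨d, rfl⟩ := Nat.exists_eq_add_of_le hn
    rw [← eventually_window_extend hP d d]
    rw [show (-(N + d : ℕ) : ℤ) = -N - d by push_cast; ring,
      show 2 * (N + d) = 2 * N + d + d by ring]
  rw [eventually_congr key, eventually_const]

/-- The ultrafilter cannot tell a sequence from its translates by a local predicate. -/
theorem eventually_move_iff {P : (ℤ → ℕ) → Prop} (hP : IsLocal P) (k : ℤ) :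
    (∀ᶠ s in seqUltrafilter, P (move k s)) ↔ ∀ᶠ s in seqUltrafilter, P s := by
  obtain ⟨N, hN⟩ := hP
  have hM : DependsOn (fun s => P (move k s))
      (Set.Ico (-(N + k.natAbs : ℕ) : ℤ) (N + k.natAbs : ℕ)) := by
    refine fun x y h => hN fun i hi => h _ ?_
    simp only [Set.mem_Ico] at hi ⊢
    omega
  rw [eventually_seqUltrafilter hM, eventually_seqUltrafilter hN, eventually_window_move,
    ← eventually_window_extend hN (k.natAbs + k).toNat (k.natAbs - k).toNat]
  rw [show (-(N + k.natAbs : ℕ) - k : ℤ) = -N - (k.natAbs + k).toNat by omega,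
    show 2 * (N + k.natAbs) = 2 * N + (k.natAbs + k).toNat + (k.natAbs - k).toNat by omega]

theorem eventually_window_gt (c n : ℕ) : ∀ a : ℤ,
    ∀ᶠ s : ℤ → ℕ in window a n, ∀ i ∈ Set.Ico a (a + n), c < s i := by
  induction n with
  | zero =>
    intro a
    rw [eventually_window_zero]
    intro i hi
    simp only [Set.mem_Ico] at hi
    omega
  | succ n ih =>
    intro a
    rw [eventually_window_succ]
    filter_upwards [eventually_hyperfilter_ge (c + 1)] with b hb
    filter_upwards [ih (a + 1)] with s hs i hi
    by_cases h : i = a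
    · subst h; simpa using hb
    · rw [Function.update_of_ne h]
      refine hs i ?_
      simp only [Set.mem_Ico] at hi ⊢
      push_cast at hi
      omega

theorem eventually_lt_succ (i : ℤ) : ∀ᶠ s : ℤ → ℕ in seqUltrafilter, s i < s (i + 1) := by
  have h : ∀ᶠ s : ℤ → ℕ in seqUltrafilter, s (-1) < s 0 := by
    rw [eventually_seqUltrafilter (N := 1) (P := fun s => s (-1) < s 0)]
    · rw [show 2 * 1 = 1 + 1 from rfl, eventually_window_succ]
      refine .of_forall fun c => ?_
      filter_upwards [eventually_window_gt c 1 0] with s hs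
      simpa using hs 0 (by simp)
    · intro x y h
      simp only [h (-1) (by simp), h 0 (by simp)]
  have hloc : IsLocal fun s => s (-1) < s 0 := (IsLocal.eval _).comp₂ (IsLocal.eval _) (· < ·)
  have := (eventually_move_iff hloc (i + 1)).2 h
  simp only [move_apply] at this
  simpa [show -1 + (i + 1) = i by ring] using this

/-! ### Iterated ultrapowers -/

/-- Functions on bi-infinite sequences that look at finitely many terms. -/
def LocalFun (D : Type) : Type := {f : (ℤ → ℕ) → D // IsLocal f}

/-- The one-sorted structure obtained from a structure whose sorts are the natural numbers. The
function `x` placed at level `i` denotes, for each sequence `s`, the element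
`x (move i s)` of the sort `s i`; membership is tested between levels `0` and `1`. -/
def ultrapower {D : Type} (M : Model ℕ D) : Model Unit (LocalFun D) where
  E _ x y := ∀ᶠ s in seqUltrafilter, M.E (s 0) (x.1 s) (y.1 s)
  mem _ _ x y := ∀ᶠ s in seqUltrafilter, M.mem (s 0) (s 1) (x.1 s) (y.1 (move 1 s))
  refl _ x := .of_forall fun s => M.refl _ _
  symm _ x y h := h.mono fun s => M.symm _ _ _
  trans _ x y z h h' := by filter_upwards [h, h'] with s using M.trans _ _ _ _
  mem_congr _ _ x x' y y' hx hy h := by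
    have hloc : IsLocal fun s => M.E (s 0) (y.1 s) (y'.1 s) :=
      (IsLocal.eval 0).comp₂ (y.2.comp₂ y'.2 Prod.mk) fun a p => M.E a p.1 p.2
    filter_upwards [hx, (eventually_move_iff hloc 1).2 hy, h] with s h₁ h₂ h₃
    exact M.mem_congr _ _ _ _ _ _ h₁ h₂ h₃

section Ultrapower

variable {D : Type} (M : Model ℕ D)

/-- The value at `s` of an assignment of local functions, each one placed at the level of its
variable. -/
def place (v : ℕ → ℕ → LocalFun D) (s : ℤ → ℕ) : ℕ → ℕ → D := fun i n => (v i n).1 (move i s)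

theorem place_cons (i : ℕ) (x : LocalFun D) (v : ℕ → ℕ → LocalFun D) (s : ℤ → ℕ) :
    place (cons i x v) s = cons i (x.1 (move i s)) (place v s) :=
  comp_cons i x v fun j y => y.1 (move j s)

/-- Truth of a fixed formula in the type structure along `s` looks at finitely many terms of `s`
only, uniformly in the parameters. -/
theorem isLocal_sat (φ : Fml TSTRel) : ∀ {P : Type} (u : (ℤ → ℕ) → P → ℕ → ℕ → D),
    (∀ i n, IsLocal fun s p => u s p i n) →
      IsLocal fun s p => (M.comap fun i : ℕ => s i).Sat (u s p) φ := by
  induction φ with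
  | bot => intro P u _; exact IsLocal.const fun _ => False
  | eq i m n =>
    intro P u hu
    exact (IsLocal.eval i).comp₂ ((hu i m).comp₂ (hu i n) Prod.mk)
      fun a q p => M.E a (q.1 p) (q.2 p)
  | mem i j _ m n =>
    intro P u hu
    exact ((IsLocal.eval i).comp₂ (IsLocal.eval j) Prod.mk).comp₂
      ((hu i m).comp₂ (hu j n) Prod.mk) fun a q p => M.mem a.1 a.2 (q.1 p) (q.2 p)
  | imp φ ψ h₁ h₂ =>
    intro P u hu
    exact (h₁ u hu).comp₂ (h₂ u hu) fun A B p => A p → B p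
  | all i φ ih =>
    intro P u hu
    refine (ih (P := P × D) (fun s q => cons i q.2 (u s q.1)) fun j n => ?_).comp
      fun A p => ∀ d, A (p, d)
    by_cases hji : j = i
    · subst hji
      cases n with
      | zero => simpa using IsLocal.const fun q : P × D => q.2
      | succ n => simpa using (hu j n).comp fun f (q : P × D) => f q.1
    · simpa [cons_of_ne hji] using (hu j n).comp fun f (q : P × D) => f q.1

theorem isLocal_place (v : ℕ → ℕ → LocalFun D) (i n : ℕ) : IsLocal fun s => place v s i n :=
  (v i n).2.comp_move i

/-- Łoś's theorem: a formula of type theory, read in the iterated ultrapower with all types equal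
to it, is true if and only if it is true along almost every sequence. -/
theorem sat_ultrapower [Nonempty D] (φ : Fml TSTRel) : ∀ v : ℕ → ℕ → LocalFun D,
    ((ultrapower M).comap fun _ : ℕ => ()).Sat v φ ↔
      ∀ᶠ s in seqUltrafilter, (M.comap fun i : ℕ => s i).Sat (place v s) φ := by
  induction φ with
  | bot => intro v; simp [seqUltrafilter.neBot.ne]
  | eq i m n =>
    intro v
    have hloc : IsLocal fun s => M.E (s 0) ((v i m).1 s) ((v i n).1 s) :=
      (IsLocal.eval 0).comp₂ ((v i m).2.comp₂ (v i n).2 Prod.mk) fun a p => M.E a p.1 p.2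
    refine (eventually_move_iff hloc i).symm.trans ?_
    simp [place, Model.comap]
  | mem i j hij m n =>
    intro v
    have hloc : IsLocal fun s => M.mem (s 0) (s 1) ((v i m).1 s) ((v j n).1 (move 1 s)) :=
      ((IsLocal.eval 0).comp₂ (IsLocal.eval 1) Prod.mk).comp₂
        ((v i m).2.comp₂ ((v j n).2.comp_move 1) Prod.mk) fun a p => M.mem a.1 a.2 p.1 p.2
    refine (eventually_move_iff hloc i).symm.trans ?_
    have hj : (j : ℤ) = 1 + i := by subst hij; push_cast; ring
    simp [place, Model.comap, hj]
  | imp φ ψ h₁ h₂ => intro v; simp [h₁, h₂, Ultrafilter.eventually_imp]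
  | all i φ ih =>
    intro v
    simp only [Model.sat_all, ih, place_cons]
    constructor
    · intro h
      by_contra hn
      rw [← Ultrafilter.eventually_not] at hn
      -- counterexamples along `s`; choosing one from this set alone makes the choice local
      let A : (ℤ → ℕ) → D → Prop := fun s d =>
        ¬ (M.comap fun i : ℕ => s i).Sat (cons i d (place v s)) φ
      have hA : IsLocal A := by
        refine (isLocal_sat M φ (fun s d => cons i d (place v s)) fun j n => ?_).comp
          fun B d => ¬ B d
        by_cases hji : j = i
        · subst hji
          cases n with
          | zero => simpa using IsLocal.const fun d : D => d
          | succ n => simpa using (isLocal_place v j n).comp fun a (_ : D) => a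
        · simpa [cons_of_ne hji] using (isLocal_place v j n).comp fun a (_ : D) => a
      let x : LocalFun D :=
        ⟨fun s => Classical.epsilon (A (move (-i) s)), (hA.comp_move (-i)).comp Classical.epsilon⟩
      obtain ⟨s, hs, hs'⟩ := ((h x).and hn).exists
      have hex : ∃ d, A s d := not_forall.1 hs'
      have hx : A s (x.1 (move i s)) := by
        simpa [x] using Classical.epsilon_spec hex
      exact hx hs
    · intro h x
      filter_upwards [h] with s hs using hs _

/-- What holds along every increasing sequence holds along almost every sequence. -/
theorem eventually_sat_of_strictMono {φ : Fml TSTRel}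
    (h : ∀ s : ℕ → ℕ, StrictMono s → ∀ w, (M.comap s).Sat w φ) :
    ∀ᶠ s : ℤ → ℕ in seqUltrafilter, ∀ w, (M.comap fun i : ℕ => s i).Sat w φ := by
  obtain ⟨N, hN⟩ := isLocal_sat M φ (P := ℕ → ℕ → D) (fun _ w => w) fun i n =>
    IsLocal.const fun w : ℕ → ℕ → D => w i n
  have hinc : ∀ᶠ s : ℤ → ℕ in seqUltrafilter, ∀ i ∈ Finset.range N, s i < s (i + 1) :=
    (eventually_all_finset _).2 fun i _ => eventually_lt_succ i
  filter_upwards [hinc] with s hs w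
  -- replace the terms beyond the window of `φ` to get a strictly increasing sequence
  let s' : ℤ → ℕ := fun i => if i < N then s i else s N + (i - N).toNat
  have hmono : StrictMono fun i : ℕ => s' i := by
    refine strictMono_nat_of_lt_succ fun n => ?_
    rcases lt_trichotomy (n + 1) N with hn | hn | hn
    · have := hs n (Finset.mem_range.2 (by omega))
      have h₁ : (n : ℤ) < N := by omega
      have h₂ : (n : ℤ) + 1 < N := by omega
      simpa [s', h₁, h₂] using this
    · have := hs n (Finset.mem_range.2 (by omega))
      have h₁ : (n : ℤ) < N := by omega
      have h₂ : (n : ℤ) + 1 = N := by omega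
      simpa [s', h₁, h₂] using this
    · have h₁ : ¬ (n : ℤ) < N := by omega
      have h₂ : ¬ (n : ℤ) + 1 < N := by omega
      simp only [s', h₁, h₂, Nat.cast_add, Nat.cast_one, if_false]
      omega
  have heq := congrFun (hN (x := s) (y := s') fun i hi => by simp [s', hi.2]) w
  simp only at heq
  rw [heq]
  exact h _ hmono w

end Ultrapower

/-! ### Stratified formulas and formulas of type theory -/

theorem cons_comm {S D : Type*} {s t : S} (h : s ≠ t) (a b : D) (v : S → ℕ → D) :
    cons s a (cons t b v) = cons t b (cons s a v) := by
  funext r n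
  by_cases hs : r = s
  · subst hs; cases n <;> simp [cons_of_ne h]
  · by_cases ht : r = t
    · subst ht; cases n <;> simp [cons_of_ne hs]
    · simp [cons_of_ne hs, cons_of_ne ht]

namespace Model

variable {D : Type*}

theorem sat_tstExt (M : Model ℕ D) (i : ℕ) (v : ℕ → ℕ → D) :
    M.Sat v (tstExt i) ↔
      ∀ x y, M.E (i + 1) x y ↔ ∀ z, M.mem i (i + 1) z x ↔ M.mem i (i + 1) z y := by
  simp [tstExt, cons]

theorem sat_tstComp (M : Model ℕ D) (i : ℕ) (φ : Fml TSTRel) (v : ℕ → ℕ → D) :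
    M.Sat v (tstComp i φ) ↔ ∃ A, ∀ x, M.mem i (i + 1) x A ↔ M.Sat (cons i x v) φ := by
  have hne : i + 1 ≠ i := Nat.succ_ne_self i
  simp only [tstComp, sat_ex, sat_all, sat_iff, sat_mem, cons_self_zero, cons_of_ne hne]
  simp only [cons_comm hne.symm, sat_rename_shift]

theorem sat_nfExt (X : Model Unit D) (v : Unit → ℕ → D) :
    X.Sat v nfExt ↔ ∀ x y, X.E () x y ↔ ∀ z, X.mem () () z x ↔ X.mem () () z y := by
  simp [nfExt, cons]

theorem sat_nfComp (X : Model Unit D) (φ : Fml NFRel) (v : Unit → ℕ → D) :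
    X.Sat v (nfComp φ) ↔ ∃ A, ∀ x, X.mem () () x A ↔ X.Sat (cons () x v) φ := by
  simp only [nfComp, sat_ex, sat_all, sat_iff, sat_mem, sat_rename, cons_comp_lift, cons_shift]
  simp [cons]

end Model

/-- A stratified formula has the same meaning as some formula of type theory, in which the
variable `n` becomes a variable of type `σ n`. -/
theorem exists_tst_of_isStratification (φ : Fml NFRel) : ∀ σ g : ℕ → ℕ, IsStratification σ φ →
    ∃ φ' : Fml TSTRel, ∀ {D : Type} (X : Model Unit D) (v : Unit → ℕ → D) (w : ℕ → ℕ → D),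
      (∀ n, w (σ n) (g n) = v () n) → (X.Sat v φ ↔ (X.comap fun _ : ℕ => ()).Sat w φ') := by
  induction φ with
  | bot => intro σ g _; exact ⟨.bot, fun X v w _ => Iff.rfl⟩
  | eq _ m n =>
    intro σ g (h : σ m = σ n)
    refine ⟨.eq (σ m) (g m) (g n), fun X v w hw => ?_⟩
    have hn := hw n
    rw [← h] at hn
    simp [hw m, hn, Model.comap]
  | mem _ _ _ m n =>
    intro σ g (h : σ m + 1 = σ n)
    refine ⟨.mem (σ m) (σ n) h.symm (g m) (g n), fun X v w hw => ?_⟩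
    simp [hw m, hw n, Model.comap]
  | imp φ ψ h₁ h₂ =>
    intro σ g h
    obtain ⟨φ', hφ⟩ := h₁ σ g h.1
    obtain ⟨ψ', hψ⟩ := h₂ σ g h.2
    exact ⟨.imp φ' ψ', fun X v w hw => imp_congr (hφ X v w hw) (hψ X v w hw)⟩
  | all _ φ ih =>
    rintro σ g ⟨k, hk⟩
    obtain ⟨φ', hφ⟩ := ih _ (fun n => match n with | 0 => 0 | j + 1 => shift k (σ j) (g j)) hk
    refine ⟨.all k φ', fun X v w hw => forall_congr' fun d => hφ X _ _ fun n => ?_⟩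
    cases n with
    | zero => simp
    | succ n => simp [cons_shift, hw]

/-- Forget the types: the variable `n` of type `i` becomes the variable `g i n`. -/
noncomputable def toNF : (ℕ → ℕ → ℕ) → Fml TSTRel → Fml NFRel
  | _, .bot => .bot
  | g, .eq i m n => .eq () (g i m) (g i n)
  | g, .mem i j _ m n => .mem () () trivial (g i m) (g j n)
  | g, .imp φ ψ => .imp (toNF g φ) (toNF g ψ)
  | g, .all i φ => .all () (toNF (cons i 0 fun j n => g j n + 1) φ)

theorem sat_toNF {D : Type*} (X : Model Unit D) (φ : Fml TSTRel) :
    ∀ (g : ℕ → ℕ → ℕ) (v : Unit → ℕ → D),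
      X.Sat v (toNF g φ) ↔ (X.comap fun _ : ℕ => ()).Sat (fun i n => v () (g i n)) φ := by
  induction φ with
  | bot => intros; rfl
  | eq => intros; rfl
  | mem => intros; rfl
  | imp φ ψ h₁ h₂ => intro g v; simp [toNF, h₁, h₂]
  | all i φ ih =>
    intro g v
    refine forall_congr' fun d => (ih _ _).trans ?_
    rw [comp_cons i 0 (fun j n => g j n + 1) fun _ k => cons () d v () k]
    simp

theorem isStratification_toNF (φ : Fml TSTRel) : ∀ (g : ℕ → ℕ → ℕ) (σ : ℕ → ℕ),
    (∀ i n, σ (g i n) = i) → IsStratification σ (toNF g φ) := by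
  induction φ with
  | bot => intros; trivial
  | eq i m n => intro g σ h; simp [toNF, IsStratification, h]
  | mem i j hij m n => intro g σ h; simp [toNF, IsStratification, h, hij]
  | imp φ ψ h₁ h₂ => intro g σ h; exact ⟨h₁ g σ h, h₂ g σ h⟩
  | all i φ ih =>
    intro g σ h
    refine ⟨i, ih _ _ fun j n => ?_⟩
    by_cases hji : j = i
    · subst hji; cases n <;> simp [h]
    · simp [cons_of_ne hji, h]

/-- A one-sorted structure is a model of NF if the type structure all of whose types are equal to
it is a model of TST. -/
theorem sat_NF_of_sat_TST {D : Type} (X : Model Unit D)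
    (h : ∀ φ ∈ TST, ∀ w, (X.comap fun _ : ℕ => ()).Sat w φ) (v : Unit → ℕ → D) :
    ∀ ψ ∈ NF, X.Sat v ψ := by
  rintro ψ (rfl | ⟨φ, ⟨σ, hσ⟩, ⟨ss, rfl⟩, -⟩)
  · rw [Model.sat_nfExt]
    exact (Model.sat_tstExt _ 0 fun _ _ => v () 0).1 (h _ (Or.inl ⟨0, rfl⟩) _)
  · refine X.sat_alls_of_forall (fun v => ?_) ss v
    obtain ⟨φ', hφ'⟩ := exists_tst_of_isStratification φ σ
      (fun n => match n with | 0 => 0 | j + 1 => shift (σ 0) (σ (j + 1)) j) hσ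
    obtain ⟨χ, hχ⟩ := (tstComp (σ 0) φ').exists_isUnivClosure
    have hχT : χ ∈ TST := Or.inr ⟨_, _, hχ⟩
    obtain ⟨⟨ss', rfl⟩, -⟩ := hχ
    have hcomp := Model.forall_of_sat_alls _ ss' (h _ hχT) fun _ n => v () n
    rw [Model.sat_tstComp] at hcomp
    rw [Model.sat_nfComp]
    obtain ⟨A, hA⟩ := hcomp
    refine ⟨A, fun x => (hA x).trans (hφ' X _ _ fun n => ?_).symm⟩
    cases n with
    | zero => simp
    | succ n => simp [cons_shift]

/-- The type structure all of whose types are equal to a model of NF is a model of TST. -/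
theorem sat_TST_of_sat_NF {D : Type} (X : Model Unit D) (h : ∀ ψ ∈ NF, ∀ v, X.Sat v ψ)
    (w : ℕ → ℕ → D) : ∀ φ ∈ TST, (X.comap fun _ : ℕ => ()).Sat w φ := by
  rintro φ (⟨i, rfl⟩ | ⟨i, φ, ⟨ss, rfl⟩, -⟩)
  · rw [Model.sat_tstExt]
    exact (Model.sat_nfExt X fun _ => w 0).1 (h _ (Or.inl rfl) _)
  · refine Model.sat_alls_of_forall _ (fun w => ?_) ss w
    -- the variable `x` of the axiom gets index `0`, the parameters are numbered by pairs
    let g : ℕ → ℕ → ℕ := cons i 0 fun j n => Nat.pair j n + 1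
    have hstrat : Stratified (toNF g φ) := by
      refine ⟨fun n => match n with | 0 => i | k + 1 => k.unpair.1, ?_⟩
      refine isStratification_toNF φ _ _ fun j n => ?_
      by_cases hji : j = i
      · subst hji; cases n <;> simp [g]
      · simp [g, cons_of_ne hji]
    obtain ⟨χ, hχ⟩ := (nfComp (toNF g φ)).exists_isUnivClosure
    have hχT : χ ∈ NF := Or.inr ⟨_, hstrat, hχ⟩
    obtain ⟨⟨ss', rfl⟩, -⟩ := hχ
    have hcomp := Model.forall_of_sat_alls _ ss' (h _ hχT) fun _ k => w k.unpair.1 k.unpair.2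
    rw [Model.sat_nfComp] at hcomp
    rw [Model.sat_tstComp]
    obtain ⟨A, hA⟩ := hcomp
    refine ⟨A, fun x => (hA x).trans ?_⟩
    rw [sat_toNF, comp_cons i 0 (fun j n => Nat.pair j n + 1) fun _ k => cons () x _ () k]
    simp

/-! ### The two consistency transfers -/

theorem closed_of_mem_TST {φ : Fml TSTRel} (h : φ ∈ TST) : φ.Closed := by
  obtain ⟨i, rfl⟩ | ⟨i, φ, -, h⟩ := h
  · intro s n
    simp [tstExt, Fml.iff, Fml.and, Fml.neg, Fml.FreeIn]
    omega
  · exact h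

theorem closed_of_mem_NF {φ : Fml NFRel} (h : φ ∈ NF) : φ.Closed := by
  obtain rfl | ⟨φ, -, -, h⟩ := h
  · intro s n
    simp [nfExt, Fml.iff, Fml.and, Fml.neg, Fml.FreeIn]
  · exact h

theorem consistent_TTT_of_consistent_NF (lam : Ordinal.{u}) (h : Consistent NF) :
    Consistent (TTT lam) := by
  obtain ⟨X, hX⟩ := exists_model h fun φ => closed_of_mem_NF
  refine (X.comap fun _ : Set.Iio lam => ()).consistent ?_
  rintro v _ ⟨s, hs, φ, hφ, rfl⟩
  exact (Model.sat_mapSort hs.injective _ _ φ v).2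
    (sat_TST_of_sat_NF X (fun ψ hψ v => hX v ψ hψ) _ φ hφ)

/-- Tangled type theory with the natural numbers as types. -/
def natTTT : Set (Fml fun a b : ℕ => a < b) :=
  {ψ | ∃ (s : ℕ → ℕ) (hs : StrictMono s), ∃ φ ∈ TST,
    ψ = φ.mapSort s fun i j (h : j = i + 1) => hs (h.symm ▸ Nat.lt_succ_self i)}

theorem consistent_natTTT {lam : Ordinal.{u}} (hlam : Order.IsSuccLimit lam)
    (h : Consistent (TTT lam)) : Consistent natTTT := by
  intro hbot
  let e : ℕ → Set.Iio lam := fun n => ⟨n, Ordinal.natCast_lt_of_isSuccLimit hlam n⟩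
  have he : StrictMono e := fun m n hmn => Subtype.mk_lt_mk.2 (Nat.cast_lt.2 hmn)
  refine h ((hbot.mapSort (R' := TTTRel lam) he.injective fun a b hab => he hab).mono ?_)
  rintro _ ⟨_, ⟨s, hs, φ, hφ, rfl⟩, rfl⟩
  exact ⟨fun i => e (s i), he.comp hs, φ, hφ, mapSort_mapSort _ _ _ _ _ φ⟩

theorem consistent_NF_of_consistent_natTTT (h : Consistent natTTT) : Consistent NF := by
  obtain ⟨M, hM⟩ := exists_model h (by
    rintro _ ⟨s, hs, φ, hφ, rfl⟩ t n hf
    obtain ⟨r, -, hr⟩ := freeIn_mapSort hs.injective _ φ t n hf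
    exact closed_of_mem_TST hφ r n hr)
  have hmono : ∀ φ ∈ TST, ∀ s : ℕ → ℕ, StrictMono s → ∀ w, (M.comap s).Sat w φ := by
    intro φ hφ s hs w
    have := hM (fun t => w (Function.invFun s t)) _ ⟨s, hs, φ, hφ, rfl⟩
    rw [Model.sat_mapSort hs.injective] at this
    simpa [Function.leftInverse_invFun hs.injective _] using this
  have : Nonempty (LocalFun ℕ) := ⟨⟨fun _ => 0, IsLocal.const 0⟩⟩
  refine (ultrapower M).consistent (sat_NF_of_sat_TST _ fun φ hφ w => ?_)
  rw [sat_ultrapower]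
  filter_upwards [eventually_sat_of_strictMono M (hmono φ hφ)] with s hs using hs _

end Tangled

theorem mainTheorem3 (lam : Ordinal.{u}) (hlam : Order.IsSuccLimit lam) :
    Tangled.Consistent (Tangled.TTT lam) ↔ Tangled.Consistent Tangled.NF :=
  ⟨fun h => Tangled.consistent_NF_of_consistent_natTTT (Tangled.consistent_natTTT hlam h),
    Tangled.consistent_TTT_of_consistent_NF lam⟩
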